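/- Let $\mathbb K$ be a field, $V$ a $\mathbb K$-vector space with basis $v_1,\dots,v_n$, and $G$ a finite abelian group acting linearly and diagonally on $V$: $g v_i=\chi_i(g)v_i$ with characters $\chi_i:G\to\mathbb K^*$. For $Q=(q_{ij})_{1\le i,j\le n}$ with $q_{ij}\in\mathbb K^*$ and $\kappa(v_i,v_j)=\sum_{g\in G}\kappa_g(v_i,v_j)\,t_g\in\mathbb KG$ for $1\le i,j\le n$, let $\mathcal H_{Q,\kappa}$ be the associative $\mathbb K$-algebra generated by $v_1,\dots,v_n$ and $t_g$ $(g\in G)$, with $t_1=1$, subject to $$t_gt_h=t_{gh},\qquad t_g v=g(v)t_g,\qquad v_jv_i=q_{ij}v_iv_j+\kappa(v_i,v_j)$$ for all $g,h\in G$, $v\in V$, $1\le i,j\le n$. Call $\mathcal H_{Q,\kappa}$ a *quantum Drinfeld Hecke algebra* if the monomials $v_1^{\alpha_1}\cdots v_n^{\alpha_n}t_g$ ($\alpha\in\mathbb N^n$, $g\in G$) form a $\mathbb K$-basis of it. Call $Q$ a *quantum system of parameters* if $q_{ij}=q_{ji}^{-1}$ and $q_{ii}=1$ for all $i,j$, and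 call $\kappa$ a *quantum 2-form* if $\kappa(v_i,v_i)=0$ and $\kappa(v_j,v_i)=-q_{ij}^{-1}\kappa(v_i,v_j)$ for all $i,j$. (1) For all $Q,\kappa$: $\mathcal H_{Q,\kappa}$ is a quantum Drinfeld Hecke algebra if and only if $Q$ is a quantum system of parameters, $\kappa$ is a quantum 2-form, and for all $g\in G$ and $i\ne j$, $\kappa_g(v_i,v_j)\neq0$ implies $\chi_i=\chi_j^{-1}$ and $\chi_k(g)=q_{ki}q_{kj}$ for all $k\ne i,j$. (2) Put $G^{ij}=\{g\in G:\chi_k(g)=q_{ki}q_{kj}\text{ for all }k\neq i,j\}$. For scalars $c=(c_g^{ij})$ in $\mathbb K$ let $\mathcal F_{Q,c}$ be the quotient of the skew group algebra $\mathbb K\langle v_1,\dots,v_n\rangle\# G=T(V)\#G$ by the relations, for $1\le i<j\le n$, $$v_jv_i-q_{ij}v_iv_j=\begin{cases}\sum_{g\in G^{ij}}c_g^{ij}\,g&\text{if }\chi_i=\chi_j^{-1},\\ 0&\text{otherwise.}\end{cases}$$ Then the quantum Drinfeld Hecke algebras are exactly the algebras $\mathcal F_{Q,c}$ with $Q$ a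 quantum system of parameters and $c$ arbitrary. That is, for all $Q,\kappa$, $\mathcal H_{Q,\kappa}$ is a quantum Drinfeld Hecke algebra if and only if $Q$ is a quantum system of parameters and for some $c$ there is an isomorphism of $\mathbb K$-algebras $\mathcal F_{Q,c}\cong\mathcal H_{Q,\kappa}$ with $v_i\mapsto v_i$ and $g\mapsto t_g$; and for every quantum system of parameters $Q$ and every $c$ there is a $\kappa$ such that $\mathcal H_{Q,\kappa}$ is a quantum Drinfeld Hecke algebra and such an isomorphism exists. -/

import Mathlib

namespace QuantumDrinfeldHecke

noncomputable section

variable {K V G : Type*} [Field K] [AddCommGroup V] [Module K V] [Group G] {n : ℕ}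

/-! ### Parameters -/

/-- A matrix of nonzero scalars is a quantum system of parameters if
`q_{ij} = q_{ji}⁻¹` and `q_{ii} = 1` for all `i, j`. -/
def IsQuantumSystem (Q : Fin n → Fin n → Kˣ) : Prop :=
  ∀ i j, Q i j = (Q j i)⁻¹ ∧ Q i i = 1

/-- A parameter `κ`, with values `κ(v_i, v_j) = κ i j` in the group algebra, is a quantum `2`-form
if `κ(v_i, v_i) = 0` and `κ(v_j, v_i) = -q_{ij}⁻¹ κ(v_i, v_j)` for all `i, j`. -/
def IsQuantumTwoForm (Q : Fin n → Fin n → Kˣ) (κ : Fin n → Fin n → MonoidAlgebra K G) : Prop :=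
  ∀ i j, κ i i = 0 ∧ κ j i = -((((Q i j)⁻¹ : Kˣ) : K) • κ i j)

/-! ### The algebra `H_{Q,κ}` by generators and relations -/

/-- The free associative algebra on symbols `v_1, …, v_n` and `t_g` for `g` in `G`. -/
abbrev FreeAlg (K G : Type*) [Field K] (n : ℕ) : Type _ := FreeAlgebra K (Fin n ⊕ G)

/-- The free generator `v_i`. -/
def freeV (K G : Type*) [Field K] {n : ℕ} (i : Fin n) : FreeAlg K G n := FreeAlgebra.ι K (Sum.inl i)

/-- The free generator `t_g`. -/
def freeT (K : Type*) {G : Type*} [Field K] (n : ℕ) (g : G) : FreeAlg K G n :=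
  FreeAlgebra.ι K (Sum.inr g)

/-- A vector of `V`, expanded in the basis `b = (v_1, …, v_n)`, as an element of the free algebra. -/
def freeVec (G : Type*) (b : Module.Basis (Fin n) K V) (v : V) : FreeAlg K G n :=
  ∑ i, b.repr v i • freeV K G i

variable [Fintype G]

/-- The defining relations of `H_{Q,κ}`; the generator `t_1` is identified with `1`. -/
inductive HRel (b : Module.Basis (Fin n) K V) (ρ : Representation K G V)
    (Q : Fin n → Fin n → Kˣ) (κ : Fin n → Fin n → MonoidAlgebra K G) :
    FreeAlg K G n → FreeAlg K G n → Prop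
  | one : HRel b ρ Q κ (freeT K n 1) 1
  | mul (g h : G) : HRel b ρ Q κ (freeT K n g * freeT K n h) (freeT K n (g * h))
  | act (g : G) (v : V) :
      HRel b ρ Q κ (freeT K n g * freeVec G b v) (freeVec G b (ρ g v) * freeT K n g)
  | comm (i j : Fin n) :
      HRel b ρ Q κ (freeV K G j * freeV K G i)
        ((Q i j : K) • (freeV K G i * freeV K G j) + ∑ g, (κ i j).coeff g • freeT K n g)

/-- The algebra `H_{Q,κ}`. -/
abbrev H (b : Module.Basis (Fin n) K V) (ρ : Representation K G V)
    (Q : Fin n → Fin n → Kˣ) (κ : Fin n → Fin n → MonoidAlgebra K G) : Type _ :=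
  RingQuot (HRel b ρ Q κ)

/-- The image of `v_i` in `H_{Q,κ}`. -/
def H.v (b : Module.Basis (Fin n) K V) (ρ : Representation K G V)
    (Q : Fin n → Fin n → Kˣ) (κ : Fin n → Fin n → MonoidAlgebra K G) (i : Fin n) : H b ρ Q κ :=
  RingQuot.mkAlgHom K (HRel b ρ Q κ) (freeV K G i)

/-- The image of `t_g` in `H_{Q,κ}`. -/
def H.t (b : Module.Basis (Fin n) K V) (ρ : Representation K G V)
    (Q : Fin n → Fin n → Kˣ) (κ : Fin n → Fin n → MonoidAlgebra K G) (g : G) : H b ρ Q κ :=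
  RingQuot.mkAlgHom K (HRel b ρ Q κ) (freeT K n g)

/-- The monomial `v_1^{α_1} ⋯ v_n^{α_n} t_g` in `H_{Q,κ}`, for a pair `(α, g)`. -/
def H.monomial (b : Module.Basis (Fin n) K V) (ρ : Representation K G V)
    (Q : Fin n → Fin n → Kˣ) (κ : Fin n → Fin n → MonoidAlgebra K G)
    (x : (Fin n → ℕ) × G) : H b ρ Q κ :=
  (List.ofFn fun i => H.v b ρ Q κ i ^ x.1 i).prod * H.t b ρ Q κ x.2

/-- `H_{Q,κ}` is a quantum Drinfeld Hecke algebra if the monomials `v_1^{α_1} ⋯ v_n^{α_n} t_g`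
form a `K`-basis of it. -/
def IsQuantumDrinfeldHecke (b : Module.Basis (Fin n) K V) (ρ : Representation K G V)
    (Q : Fin n → Fin n → Kˣ) (κ : Fin n → Fin n → MonoidAlgebra K G) : Prop :=
  LinearIndependent K (H.monomial b ρ Q κ) ∧
    Submodule.span K (Set.range (H.monomial b ρ Q κ)) = ⊤

end

end QuantumDrinfeldHecke

namespace QuantumDrinfeldHecke

noncomputable section

variable {K V G : Type*} [Field K] [AddCommGroup V] [Module K V] [Group G] {n : ℕ}

/-! ### The skew group algebra `K⟨v_1, …, v_n⟩ # G = T(V) # G` -/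

/-- The tensor algebra `T(V) = K⟨v_1, …, v_n⟩`, remembering the representation of `G` on `V`. -/
def Tensor (_ρ : Representation K G V) : Type _ := TensorAlgebra K V

instance (ρ : Representation K G V) : Ring (Tensor ρ) :=
  inferInstanceAs (Ring (TensorAlgebra K V))

instance (ρ : Representation K G V) : Algebra K (Tensor ρ) :=
  inferInstanceAs (Algebra K (TensorAlgebra K V))

/-- The algebra endomorphism of `T(V)` extending the action of `g` on `V`. -/
def Tensor.act (ρ : Representation K G V) (g : G) : Tensor ρ →ₐ[K] Tensor ρ :=
  TensorAlgebra.lift K ((TensorAlgebra.ι K (M := V)).comp (ρ g))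

/-- A vector of `V` as an element of `T(V)`. -/
def Tensor.ι (ρ : Representation K G V) : V →ₗ[K] Tensor ρ := TensorAlgebra.ι K (M := V)

theorem Tensor.act_ι (ρ : Representation K G V) (g : G) (v : V) :
    Tensor.act ρ g (Tensor.ι ρ v) = Tensor.ι ρ (ρ g v) :=
  TensorAlgebra.lift_ι_apply _ _

theorem Tensor.hom_ext {ρ : Representation K G V} {A : Type*} [Ring A] [Algebra K A]
    {f f' : Tensor ρ →ₐ[K] A} (h : ∀ v, f (Tensor.ι ρ v) = f' (Tensor.ι ρ v)) : f = f' :=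
  TensorAlgebra.hom_ext (R := K) (M := V) (LinearMap.ext h)

/-- `G` acts on `T(V)` by algebra automorphisms extending its action on `V`. -/
instance (ρ : Representation K G V) : MulSemiringAction G (Tensor ρ) where
  smul g x := Tensor.act ρ g x
  one_smul x := by
    have h : Tensor.act ρ 1 = AlgHom.id K (Tensor ρ) :=
      Tensor.hom_ext fun v => by rw [Tensor.act_ι]; simp
    exact DFunLike.congr_fun h x
  mul_smul g g' x := by
    have h : Tensor.act ρ (g * g') = (Tensor.act ρ g).comp (Tensor.act ρ g') :=
      Tensor.hom_ext fun v => by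
        rw [AlgHom.comp_apply, Tensor.act_ι, Tensor.act_ι, Tensor.act_ι]; simp
    exact DFunLike.congr_fun h x
  smul_zero g := map_zero (Tensor.act ρ g)
  smul_add g := map_add (Tensor.act ρ g)
  smul_one g := map_one (Tensor.act ρ g)
  smul_mul g := map_mul (Tensor.act ρ g)

theorem Tensor.smul_def (ρ : Representation K G V) (g : G) (x : Tensor ρ) :
    g • x = Tensor.act ρ g x := rfl

instance (ρ : Representation K G V) : SMulCommClass G K (Tensor ρ) where
  smul_comm g a x := map_smul (Tensor.act ρ g) a x

/-- The skew group algebra `T(V) # G`, with `(a ⊗ g)(a' ⊗ h) = a g(a') ⊗ gh`. -/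
abbrev Skew (ρ : Representation K G V) : Type _ := SkewMonoidAlgebra (Tensor ρ) G

/-- A vector of `V` as an element of `T(V) # G`. -/
def skewVec (ρ : Representation K G V) (v : V) : Skew ρ :=
  SkewMonoidAlgebra.single 1 (Tensor.ι ρ v)

/-- An element of `G` as an element of `T(V) # G`. -/
def skewT (ρ : Representation K G V) (g : G) : Skew ρ := SkewMonoidAlgebra.single g 1

/-! ### The factor algebras attached to a diagonal action -/

variable [Fintype G]

open Classical in
/-- `G^{ij}`: the elements `g` of `G` with `χ_k(g) = q_{ki} q_{kj}` for all `k ≠ i, j`. -/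
def Gij (χ : Fin n → G →* Kˣ) (Q : Fin n → Fin n → Kˣ) (i j : Fin n) : Finset G :=
  {g | ∀ k, k ≠ i → k ≠ j → χ k g = Q k i * Q k j}

/-- The relations imposed on `T(V) # G`, for `i < j`: the `q`-commutator `v_j v_i - q_{ij} v_i v_j`
is the combination of the elements of `G^{ij}` with coefficients `c_g^{ij}` if `χ_i = χ_j⁻¹`, and
is zero otherwise. -/
inductive FactorRel (b : Module.Basis (Fin n) K V) (ρ : Representation K G V)
    (χ : Fin n → G →* Kˣ) (Q : Fin n → Fin n → Kˣ) (c : Fin n → Fin n → G → K) :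
    Skew ρ → Skew ρ → Prop
  | inverse (i j : Fin n) (hij : i < j) (hχ : ∀ g, χ i g = (χ j g)⁻¹) :
      FactorRel b ρ χ Q c (skewVec ρ (b j) * skewVec ρ (b i))
        ((Q i j : K) • (skewVec ρ (b i) * skewVec ρ (b j)) +
          ∑ g ∈ Gij χ Q i j, c i j g • skewT ρ g)
  | other (i j : Fin n) (hij : i < j) (hχ : ¬ ∀ g, χ i g = (χ j g)⁻¹) :
      FactorRel b ρ χ Q c (skewVec ρ (b j) * skewVec ρ (b i))
        ((Q i j : K) • (skewVec ρ (b i) * skewVec ρ (b j)))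

/-- The factor algebra of `T(V) # G` with parameters `Q` and `c`. -/
abbrev Factor (b : Module.Basis (Fin n) K V) (ρ : Representation K G V)
    (χ : Fin n → G →* Kˣ) (Q : Fin n → Fin n → Kˣ) (c : Fin n → Fin n → G → K) : Type _ :=
  RingQuot (FactorRel b ρ χ Q c)

/-- `H_{Q,κ}` is the factor algebra with parameters `Q` and `c`: there is an isomorphism of
`K`-algebras that matches the generators `v_i` and `t_g` on both sides. -/
def IsFactor (b : Module.Basis (Fin n) K V) (ρ : Representation K G V)
    (χ : Fin n → G →* Kˣ) (Q : Fin n → Fin n → Kˣ) (κ : Fin n → Fin n → MonoidAlgebra K G)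
    (c : Fin n → Fin n → G → K) : Prop :=
  ∃ φ : Factor b ρ χ Q c ≃ₐ[K] H b ρ Q κ,
    (∀ i, φ (RingQuot.mkAlgHom K (FactorRel b ρ χ Q c) (skewVec ρ (b i))) = H.v b ρ Q κ i) ∧
    (∀ g, φ (RingQuot.mkAlgHom K (FactorRel b ρ χ Q c) (skewT ρ g)) = H.t b ρ Q κ g)

end

end QuantumDrinfeldHecke

/-! Everything is read off from algebras containing elements that satisfy the defining relations
(`IsModel`); `H b ρ Q κ` is the universal one.

Necessity is comparison of coefficients. When the ordered monomials are independent, reordering the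
two sides of an associativity identity and equating coefficients gives each condition: swapping
`v_i` and `v_j` twice gives the conditions on `Q` and the form identity, moving `t_x` past `v_j v_i`
gives `χ_i = χ_j⁻¹`, and the overlap `v_k v_j v_i` gives the condition on `χ_k(g)`
(`IsModel.admissible_of_linearIndependent`).

Sufficiency is by induction on `n`: the algebra on `n + 1` generators is an Ore extension `A[x; σ,
δ]` of the algebra `A` on the first `n`, with `x` the last generator. Existence of the
`σ`-derivation `δ` is the crux; the map `a ↦ [[σ a, δ a], [0, a]]` must be an algebra homomorphism,
and checking the relations on these matrices uses exactly the admissibility conditions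
(`IsModel.twist`). Letting `x` act on finitely supported sequences in `A` gives independence; the
rule `x a = σ(a) x + δ(a)` gives spanning.

For the second part, a quantum system and a quantum 2-form make the relations with `i ≥ j`
redundant, so the universal properties of the two presentations yield inverse isomorphisms
(`isFactor_of_matches`). Any `c` is realised by an admissible form (`formOf`). -/

namespace QuantumDrinfeldHecke

noncomputable section

/-! ### Algebras satisfying the defining relations -/

/-- The conditions on `Q` and `κ` that characterize quantum Drinfeld Hecke algebras. -/
structure Admissible {K G : Type*} [Field K] [Group G] {n : ℕ} (χ : Fin n → G →* Kˣ)
    (Q : Fin n → Fin n → Kˣ) (κ : Fin n → Fin n → MonoidAlgebra K G) : Prop where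
  system : IsQuantumSystem Q
  form : IsQuantumTwoForm Q κ
  inverse : ∀ g i j, i ≠ j → (κ i j).coeff g ≠ 0 → ∀ h, χ i h = (χ j h)⁻¹
  char : ∀ g i j, i ≠ j → (κ i j).coeff g ≠ 0 → ∀ k, k ≠ i → k ≠ j → χ k g = Q k i * Q k j

/-- Elements `v_i` and `t_g` of an algebra that satisfy the defining relations of `H_{Q,κ}`. -/
structure IsModel {K G A : Type*} [Field K] [Group G] [Fintype G] [Ring A] [Algebra K A] {n : ℕ}
    (χ : Fin n → G →* Kˣ) (Q : Fin n → Fin n → Kˣ) (κ : Fin n → Fin n → MonoidAlgebra K G)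
    (v : Fin n → A) (t : G → A) : Prop where
  one : t 1 = 1
  mul : ∀ g h, t g * t h = t (g * h)
  act : ∀ g i, t g * v i = (χ i g : K) • (v i * t g)
  comm : ∀ i j, v j * v i = (Q i j : K) • (v i * v j) + ∑ g, (κ i j).coeff g • t g

/-- The monomial `v_1^{α_1} ⋯ v_n^{α_n} t_g`. -/
def mon {G A : Type*} [Monoid A] {n : ℕ} (v : Fin n → A) (t : G → A) (x : (Fin n → ℕ) × G) : A :=
  (List.ofFn fun i => v i ^ x.1 i).prod * t x.2

theorem map_mon {G A B F : Type*} [Monoid A] [Monoid B] [FunLike F A B] [MonoidHomClass F A B]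
    (f : F) {n : ℕ} (v : Fin n → A) (t : G → A) (x : (Fin n → ℕ) × G) :
    f (mon v t x) = mon (fun i => f (v i)) (fun g => f (t g)) x := by
  simp only [mon, map_mul, map_list_prod, List.map_ofFn]
  congr 3
  funext i
  simp

theorem IsModel.map {K G A B : Type*} [Field K] [Group G] [Fintype G] [Ring A] [Algebra K A]
    [Ring B] [Algebra K B] {n : ℕ} {χ : Fin n → G →* Kˣ} {Q : Fin n → Fin n → Kˣ}
    {κ : Fin n → Fin n → MonoidAlgebra K G} {v : Fin n → A} {t : G → A}
    (h : IsModel χ Q κ v t) (f : A →ₐ[K] B) :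
    IsModel χ Q κ (fun i => f (v i)) (fun g => f (t g)) where
  one := by rw [h.one, map_one]
  mul g g' := by rw [← map_mul, h.mul]
  act g i := by rw [← map_mul, h.act, map_smul, map_mul]
  comm i j := by
    rw [← map_mul, h.comm]
    simp only [map_add, map_smul, map_mul, map_sum]

/-! ### The universal property of `H b ρ Q κ` -/

section

variable {K V G : Type*} [Field K] [AddCommGroup V] [Module K V] {n : ℕ}
  {b : Module.Basis (Fin n) K V}

theorem freeVec_basis (i : Fin n) : freeVec G b (b i) = freeV K G i := by
  simp [freeVec, Finsupp.single_apply, ite_smul]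

theorem freeVec_smul (a : K) (v : V) : freeVec G b (a • v) = a • freeVec G b v := by
  simp [freeVec, Finset.smul_sum, mul_smul]

theorem freeVec_sum {ι : Type*} (s : Finset ι) (f : ι → V) :
    freeVec G b (∑ i ∈ s, f i) = ∑ i ∈ s, freeVec G b (f i) := by
  simp only [freeVec, map_sum, Finsupp.coe_finsetSum, Finset.sum_apply, Finset.sum_smul]
  exact Finset.sum_comm

variable [Group G] [Fintype G] {ρ : Representation K G V} {χ : Fin n → G →* Kˣ}
  {Q : Fin n → Fin n → Kˣ} {κ : Fin n → Fin n → MonoidAlgebra K G}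

theorem isModel_H (hχ : ∀ g i, ρ g (b i) = (χ i g : K) • b i) :
    IsModel χ Q κ (H.v b ρ Q κ) (H.t b ρ Q κ) where
  one := by
    have := RingQuot.mkAlgHom_rel K (HRel.one (b := b) (ρ := ρ) (Q := Q) (κ := κ))
    simpa [H.t] using this
  mul g h := by
    have := RingQuot.mkAlgHom_rel K (HRel.mul (b := b) (ρ := ρ) (Q := Q) (κ := κ) g h)
    simpa [H.t] using this
  act g i := by
    have := RingQuot.mkAlgHom_rel K (HRel.act (b := b) (ρ := ρ) (Q := Q) (κ := κ) g (b i))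
    rw [hχ, freeVec_smul, freeVec_basis] at this
    simpa [H.t, H.v] using this
  comm i j := by
    have := RingQuot.mkAlgHom_rel K (HRel.comm (b := b) (ρ := ρ) (Q := Q) (κ := κ) i j)
    simpa [H.t, H.v] using this

theorem H.monomial_eq (x : (Fin n → ℕ) × G) :
    H.monomial b ρ Q κ x = mon (H.v b ρ Q κ) (H.t b ρ Q κ) x := rfl

section Lift

variable {A : Type*} [Ring A] [Algebra K A] {v : Fin n → A} {t : G → A}

theorem IsModel.exists_lift (h : IsModel χ Q κ v t)
    (hχ : ∀ g i, ρ g (b i) = (χ i g : K) • b i) :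
    ∃ f : H b ρ Q κ →ₐ[K] A, (∀ i, f (H.v b ρ Q κ i) = v i) ∧ ∀ g, f (H.t b ρ Q κ g) = t g := by
  let F : FreeAlg K G n →ₐ[K] A := FreeAlgebra.lift K (Sum.elim v t)
  have Fv (i : Fin n) : F (freeV K G i) = v i := by
    simp only [F, freeV, FreeAlgebra.lift_ι_apply, Sum.elim_inl]
  have Ft (g : G) : F (freeT K n g) = t g := by
    simp only [F, freeT, FreeAlgebra.lift_ι_apply, Sum.elim_inr]
  have hF : ∀ ⦃x y⦄, HRel b ρ Q κ x y → F x = F y := by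
    intro x y hxy
    cases hxy with
    | one => rw [Ft, h.one, map_one]
    | mul g g' => rw [map_mul, Ft, Ft, Ft, h.mul]
    | act g x =>
      -- The action relation is linear in the vector, so basis vectors suffice.
      have key (i : Fin n) : F (freeT K n g * freeVec G b (b i)) =
          F (freeVec G b (ρ g (b i)) * freeT K n g) := by
        rw [hχ, freeVec_smul, freeVec_basis, map_mul, map_mul, map_smul, Ft, Fv, h.act,
          smul_mul_assoc]
      rw [← b.sum_repr x]
      simp only [freeVec_sum, freeVec_smul, map_sum, map_smul, Finset.mul_sum, Finset.sum_mul,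
        mul_smul_comm, smul_mul_assoc, key]
    | comm i j =>
      simp only [map_mul, map_add, map_smul, map_sum, Ft, Fv]
      exact h.comm i j
  refine ⟨RingQuot.liftAlgHom K ⟨F, hF⟩, fun i => ?_, fun g => ?_⟩
  · rw [H.v, RingQuot.liftAlgHom_mkAlgHom_apply, Fv]
  · rw [H.t, RingQuot.liftAlgHom_mkAlgHom_apply, Ft]

theorem H.hom_ext {f f' : H b ρ Q κ →ₐ[K] A}
    (hv : ∀ i, f (H.v b ρ Q κ i) = f' (H.v b ρ Q κ i))
    (ht : ∀ g, f (H.t b ρ Q κ g) = f' (H.t b ρ Q κ g)) : f = f' := by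
  apply RingQuot.ringQuot_ext'
  apply FreeAlgebra.hom_ext
  funext x
  rcases x with i | g
  · exact hv i
  · exact ht g

end Lift

theorem H.induction {p : H b ρ Q κ → Prop} (hs : ∀ a : K, p (algebraMap K _ a))
    (hv : ∀ i, p (H.v b ρ Q κ i)) (ht : ∀ g, p (H.t b ρ Q κ g))
    (hadd : ∀ x y, p x → p y → p (x + y)) (hmul : ∀ x y, p x → p y → p (x * y))
    (x : H b ρ Q κ) : p x := by
  obtain ⟨x, rfl⟩ := RingQuot.mkAlgHom_surjective K (HRel b ρ Q κ) x
  induction x using FreeAlgebra.induction with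
  | grade0 a => rw [AlgHom.commutes]; exact hs a
  | grade1 y =>
    rcases y with i | g
    · exact hv i
    · exact ht g
  | mul x y hx hy => rw [map_mul]; exact hmul _ _ hx hy
  | add x y hx hy => rw [map_add]; exact hadd _ _ hx hy

/-- A subspace containing `1` and stable under left multiplication by the generators is
everything. -/
theorem H.eq_top_of_stable (N : Submodule K (H b ρ Q κ)) (h1 : 1 ∈ N)
    (hv : ∀ i, ∀ x ∈ N, H.v b ρ Q κ i * x ∈ N) (ht : ∀ g, ∀ x ∈ N, H.t b ρ Q κ g * x ∈ N) :
    N = ⊤ := by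
  have key : ∀ y : H b ρ Q κ, ∀ x ∈ N, y * x ∈ N := by
    intro y
    induction y using H.induction with
    | hs a => intro x hx; rw [← Algebra.smul_def]; exact N.smul_mem a hx
    | hv i => exact hv i
    | ht g => exact ht g
    | hadd y z hy hz => intro x hx; rw [add_mul]; exact N.add_mem (hy x hx) (hz x hx)
    | hmul y z hy hz => intro x hx; rw [mul_assoc]; exact hy _ (hz x hx)
  exact eq_top_iff.2 fun y _ => by simpa using key y 1 h1

end

/-- Linear independence of the monomials in some model gives it in `H_{Q,κ}`. -/
theorem linearIndependent_monomial {K V G A M : Type*} [Field K] [AddCommGroup V] [Module K V]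
    [Group G] [Fintype G] {n : ℕ} [Ring A] [Algebra K A] [AddCommGroup M] [Module K M]
    {b : Module.Basis (Fin n) K V} {ρ : Representation K G V} {χ : Fin n → G →* Kˣ}
    {Q : Fin n → Fin n → Kˣ} {κ : Fin n → Fin n → MonoidAlgebra K G}
    (hχ : ∀ g i, ρ g (b i) = (χ i g : K) • b i) {v : Fin n → A} {t : G → A}
    (h : IsModel χ Q κ v t) (e : A →ₗ[K] M) (hli : LinearIndependent K fun x => e (mon v t x)) :
    LinearIndependent K (H.monomial b ρ Q κ) := by
  obtain ⟨f, hv, ht⟩ := h.exists_lift hχ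
  apply LinearIndependent.of_comp (e ∘ₗ f.toLinearMap)
  convert hli using 1
  funext x
  simp [H.monomial_eq, map_mon, hv, ht]

end

end QuantumDrinfeldHecke
namespace QuantumDrinfeldHecke

noncomputable section

/-! ### The monomial basis, by induction on the number of generators -/

section Twist

variable {K V G : Type*} [Field K] [AddCommGroup V] [Module K V] [CommGroup G] {n : ℕ}
  {χ : Fin (n + 1) → G →* Kˣ} {Q : Fin (n + 1) → Fin (n + 1) → Kˣ}
  {κ : Fin (n + 1) → Fin (n + 1) → MonoidAlgebra K G}

theorem Admissible.castSucc (h : Admissible χ Q κ) :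
    Admissible (fun i : Fin n => χ i.castSucc) (fun i j => Q i.castSucc j.castSucc)
      (fun i j => κ i.castSucc j.castSucc) where
  system i j := h.system i.castSucc j.castSucc
  form i j := h.form i.castSucc j.castSucc
  inverse g i j hij := h.inverse g _ _ (by simpa using hij)
  char g i j hij hg k hki hkj :=
    h.char g _ _ (by simpa using hij) hg k.castSucc (by simpa using hki) (by simpa using hkj)

variable [Fintype G]

section Relations

variable {A : Type*} [Ring A] [Algebra K A] {v : Fin n → A} {t : G → A}

/-- All group elements in the support of `c` scale `v_i` by the same factor. In `IsModel.twist` this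
constancy is supplied by the condition on `χ_k(g)`. -/
theorem sum_smul_t_mul_v {χ' : Fin n → G →* Kˣ} {Q' : Fin n → Fin n → Kˣ}
    {κ' : Fin n → Fin n → MonoidAlgebra K G} (h : IsModel χ' Q' κ' v t) (c : G → K) (i : Fin n)
    (a : K) (ha : ∀ g, c g ≠ 0 → (χ' i g : K) = a) :
    (∑ g, c g • t g) * v i = a • (v i * ∑ g, c g • t g) := by
  simp only [Finset.sum_mul, Finset.mul_sum, Finset.smul_sum, smul_mul_assoc, mul_smul_comm, h.act,
    smul_smul]
  refine Finset.sum_congr rfl fun g _ => ?_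
  by_cases hg : c g = 0
  · simp [hg]
  · rw [ha g hg, mul_comm]

/-- Commutativity of `G` enters here. -/
theorem t_mul_sum_smul_t {χ' : Fin n → G →* Kˣ} {Q' : Fin n → Fin n → Kˣ}
    {κ' : Fin n → Fin n → MonoidAlgebra K G} (h : IsModel χ' Q' κ' v t) (c : G → K) (g : G) :
    t g * (∑ g', c g' • t g') = (∑ g', c g' • t g') * t g := by
  simp only [Finset.sum_mul, Finset.mul_sum, smul_mul_assoc, mul_smul_comm, h.mul, mul_comm]

/-- The `2 × 2` matrices that encode the twisted derivation attached to the last generator satisfy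
the relations among the other generators. -/
theorem IsModel.twist (hadm : Admissible χ Q κ)
    (h : IsModel (fun i : Fin n => χ i.castSucc) (fun i j => Q i.castSucc j.castSucc)
      (fun i j => κ i.castSucc j.castSucc) v t) :
    IsModel (fun i : Fin n => χ i.castSucc) (fun i j => Q i.castSucc j.castSucc)
      (fun i j => κ i.castSucc j.castSucc)
      (fun i => !![(Q i.castSucc (Fin.last n) : K) • v i,
        ∑ g, (κ i.castSucc (Fin.last n)).coeff g • t g; 0, v i])
      (fun g => !![(((χ (Fin.last n) g)⁻¹ : Kˣ) : K) • t g, 0; 0, t g]) where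
  one := by
    simp [h.one, Matrix.one_fin_two]
  mul g g' := by
    simp [h.mul, smul_smul, mul_comm]
  act g i := by
    -- The off-diagonal entry: `χ_i` and the inverse of the last character agree whenever `κ(v_i,
    -- v_last)` is nonzero.
    have hi : (((χ (Fin.last n) g)⁻¹ : Kˣ) : K) •
          ((∑ g', (κ i.castSucc (Fin.last n)).coeff g' • t g') * t g) =
        (χ i.castSucc g : K) • ((∑ g', (κ i.castSucc (Fin.last n)).coeff g' • t g') * t g) := by
      simp only [Finset.smul_sum, Finset.sum_mul]
      refine Finset.sum_congr rfl fun g' _ => ?_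
      by_cases hg : (κ i.castSucc (Fin.last n)).coeff g' = 0
      · simp [hg]
      · rw [hadm.inverse g' _ _ i.castSucc_lt_last.ne hg g]
    simp only [Matrix.mul_fin_two, Matrix.smul_of, Matrix.smul_cons, Matrix.smul_empty, smul_mul_assoc,
      mul_smul_comm, zero_mul, mul_zero, add_zero, zero_add, smul_zero, h.act,
      t_mul_sum_smul_t h]
    rw [hi]
    simp only [smul_smul, mul_comm, mul_left_comm]
  comm i j := by
    by_cases hij : i = j
    · subst hij
      have h0 : κ i.castSucc i.castSucc = 0 := (hadm.form _ i.castSucc).1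
      have h1 : Q i.castSucc i.castSucc = 1 := (hadm.system i.castSucc i.castSucc).2
      simp [h0, h1]
    · have hij' : i.castSucc ≠ j.castSucc := by simpa using hij
      -- The upper left entry says that `σ` scales `κ(v_i, v_j)` as it scales `v_i v_j`; this is the
      -- character condition for `k` the last index.
      have hsum : ∑ g, (κ i.castSucc j.castSucc).coeff g •
          (!![(((χ (Fin.last n) g)⁻¹ : Kˣ) : K) • t g, 0; 0, t g] : Matrix (Fin 2) (Fin 2) A) =
          !![((Q i.castSucc (Fin.last n) : K) * Q j.castSucc (Fin.last n)) •
            ∑ g, (κ i.castSucc j.castSucc).coeff g • t g, 0; 0,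
            ∑ g, (κ i.castSucc j.castSucc).coeff g • t g] := by
        ext a b
        fin_cases a <;> fin_cases b <;> simp [Matrix.sum_apply, Finset.smul_sum]
        refine Finset.sum_congr rfl fun g _ => ?_
        by_cases hg : (κ i.castSucc j.castSucc).coeff g = 0
        · simp [hg]
        · rw [hadm.char g _ _ hij' hg _ i.castSucc_lt_last.ne' j.castSucc_lt_last.ne',
            (hadm.system (Fin.last n) i.castSucc).1, (hadm.system (Fin.last n) j.castSucc).1,
            smul_smul, smul_smul]
          congr 1
          simp
          ring
      -- The upper right entry is the twisted Leibniz rule on `v_j v_i`. The character conditions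
      -- for the pairs `(i, last)` and `(j, last)` move both values of `κ` to the right of the
      -- `v`'s.
      have hi := sum_smul_t_mul_v h (fun g => (κ i.castSucc (Fin.last n)).coeff g) j
        (Q j.castSucc i.castSucc * Q j.castSucc (Fin.last n)) (fun g hg => by
          rw [hadm.char g _ _ i.castSucc_lt_last.ne hg _ hij'.symm j.castSucc_lt_last.ne]; simp)
      have hj := sum_smul_t_mul_v h (fun g => (κ j.castSucc (Fin.last n)).coeff g) i
        (Q i.castSucc j.castSucc * Q i.castSucc (Fin.last n)) (fun g hg => by
          rw [hadm.char g _ _ j.castSucc_lt_last.ne hg _ hij' i.castSucc_lt_last.ne]; simp)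
      have hq : (Q i.castSucc j.castSucc : K) * Q j.castSucc i.castSucc = 1 := by
        rw [(hadm.system i.castSucc j.castSucc).1]; simp
      rw [hsum]
      simp only [Matrix.mul_fin_two, hi, hj, smul_mul_assoc, mul_smul_comm, zero_mul, mul_zero,
        add_zero, zero_add, h.comm i j]
      ext a b
      fin_cases a <;> fin_cases b <;> simp [smul_smul]
      · congr 1
        ring
      · rw [← mul_assoc, hq, one_mul, add_comm]

end Relations

variable {b : Module.Basis (Fin n) K V} {ρ : Representation K G V}

/-- The twisted derivation attached to the last generator. -/
theorem exists_twistedDerivation (hadm : Admissible χ Q κ)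
    (hχ : ∀ g i, ρ g (b i) = (χ i.castSucc g : K) • b i) :
    ∃ σ δ : H b ρ (fun i j => Q i.castSucc j.castSucc) (fun i j => κ i.castSucc j.castSucc) →ₗ[K]
        H b ρ (fun i j => Q i.castSucc j.castSucc) (fun i j => κ i.castSucc j.castSucc),
      σ 1 = 1 ∧ δ 1 = 0 ∧ (∀ x y, σ (x * y) = σ x * σ y) ∧
      (∀ x y, δ (x * y) = σ x * δ y + δ x * y) ∧
      (∀ i, σ (H.v b ρ _ _ i) = (Q i.castSucc (Fin.last n) : K) • H.v b ρ _ _ i) ∧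
      (∀ i, δ (H.v b ρ _ _ i) =
        ∑ g, (κ i.castSucc (Fin.last n)).coeff g • H.t b ρ _ _ g) ∧
      (∀ g, σ (H.t b ρ _ _ g) = (((χ (Fin.last n) g)⁻¹ : Kˣ) : K) • H.t b ρ _ _ g) ∧
      (∀ g, δ (H.t b ρ _ _ g) = 0) := by
  obtain ⟨f, fv, ft⟩ := (IsModel.twist hadm
    (isModel_H (Q := fun i j => Q i.castSucc j.castSucc)
      (κ := fun i j => κ i.castSucc j.castSucc) hχ)).exists_lift hχ
  -- With lower row `(0, x)`, multiplicativity of `f` says that the upper left entry is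
  -- multiplicative and the upper right one satisfies the twisted Leibniz rule.
  have hf : ∀ x, f x 1 0 = 0 ∧ f x 1 1 = x := by
    intro x
    induction x using H.induction with
    | hs a => simp [Matrix.algebraMap_matrix_apply]
    | hv i => simp [fv]
    | ht g => simp [ft]
    | hadd x y hx hy => simp [hx, hy]
    | hmul x y hx hy => simp [Matrix.mul_apply, Fin.sum_univ_two, hx, hy]
  refine ⟨Matrix.entryLinearMap K _ 0 0 ∘ₗ f.toLinearMap,
    Matrix.entryLinearMap K _ 0 1 ∘ₗ f.toLinearMap, ?_, ?_, ?_, ?_, ?_, ?_, ?_, ?_⟩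
  · simp
  · simp
  · intro x y
    simp [Matrix.mul_apply, Fin.sum_univ_two, hf]
  · intro x y
    simp [Matrix.mul_apply, Fin.sum_univ_two, hf]
  · intro i
    simp [fv]
  · intro i
    simp [fv]
  · intro g
    simp [ft]
  · intro g
    simp [ft]

end Twist

end

end QuantumDrinfeldHecke
namespace QuantumDrinfeldHecke

noncomputable section

theorem mon_succ {G A : Type*} [Monoid A] {n : ℕ} (v : Fin (n + 1) → A) (t : G → A)
    (x : (Fin (n + 1) → ℕ) × G) :
    mon v t x = (List.ofFn fun i : Fin n => v i.castSucc ^ x.1 i.castSucc).prod *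
      v (Fin.last n) ^ x.1 (Fin.last n) * t x.2 := by
  rw [mon, List.ofFn_succ', List.concat_eq_append, List.prod_append, List.prod_singleton]

/-! ### The Ore extension by the last generator -/

section Step

variable {K V V' G : Type*} [Field K] [AddCommGroup V] [Module K V] [AddCommGroup V'] [Module K V']
  [CommGroup G] [Fintype G] {n : ℕ}

theorem IsModel.t_mul_v_pow {χ : Fin n → G →* Kˣ} {Q : Fin n → Fin n → Kˣ}
    {κ : Fin n → Fin n → MonoidAlgebra K G} {A : Type*} [Ring A] [Algebra K A] {v : Fin n → A}
    {t : G → A} (h : IsModel χ Q κ v t) (g : G) (i : Fin n) (k : ℕ) :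
    t g * v i ^ k = (χ i g ^ k : K) • (v i ^ k * t g) := by
  induction k with
  | zero => simp
  | succ k ih =>
    rw [pow_succ, ← mul_assoc, ih, smul_mul_assoc, mul_assoc, h.act, mul_smul_comm, smul_smul,
      mul_assoc, ← pow_succ]

theorem IsModel.castSucc {χ : Fin (n + 1) → G →* Kˣ} {Q : Fin (n + 1) → Fin (n + 1) → Kˣ}
    {κ : Fin (n + 1) → Fin (n + 1) → MonoidAlgebra K G} {A : Type*} [Ring A] [Algebra K A]
    {v : Fin (n + 1) → A} {t : G → A} (h : IsModel χ Q κ v t) :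
    IsModel (fun i : Fin n => χ i.castSucc) (fun i j => Q i.castSucc j.castSucc)
      (fun i j => κ i.castSucc j.castSucc) (fun i => v i.castSucc) t where
  one := h.one
  mul := h.mul
  act g i := h.act g i.castSucc
  comm i j := h.comm i.castSucc j.castSucc

/-- Add a last generator `x` to a model. -/
theorem IsModel.snoc {χ : Fin (n + 1) → G →* Kˣ} {Q : Fin (n + 1) → Fin (n + 1) → Kˣ}
    {κ : Fin (n + 1) → Fin (n + 1) → MonoidAlgebra K G} {A : Type*} [Ring A] [Algebra K A]
    {v : Fin n → A} {t : G → A} (hQ : IsQuantumSystem Q) (hκ : IsQuantumTwoForm Q κ)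
    (h : IsModel (fun i : Fin n => χ i.castSucc) (fun i j => Q i.castSucc j.castSucc)
      (fun i j => κ i.castSucc j.castSucc) v t) (x : A)
    (hv : ∀ i, x * v i = (Q i.castSucc (Fin.last n) : K) • (v i * x) +
      ∑ g, (κ i.castSucc (Fin.last n)).coeff g • t g)
    (ht : ∀ g, x * t g = (((χ (Fin.last n) g)⁻¹ : Kˣ) : K) • (t g * x)) :
    IsModel χ Q κ (Fin.snoc (α := fun _ => A) v x) t where
  one := h.one
  mul := h.mul
  act g i := by
    induction i using Fin.lastCases with
    | last => simp [ht, smul_smul]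
    | cast i => simpa using h.act g i
  comm i j := by
    induction i using Fin.lastCases with
    | last =>
      induction j using Fin.lastCases with
      | last => simp [(hQ (Fin.last n) (Fin.last n)).2, (hκ (Fin.last n) (Fin.last n)).1]
      | cast j =>
        have hq := (hQ (Fin.last n) j.castSucc).1
        have hk := (hκ j.castSucc (Fin.last n)).2
        simp only [Fin.snoc_castSucc, Fin.snoc_last]
        rw [hv, hq, hk, smul_add, smul_smul, ← Units.val_mul, inv_mul_cancel, Units.val_one,
          one_smul, add_assoc, left_eq_add]
        simp [Finset.smul_sum, smul_smul]
    | cast i =>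
      induction j using Fin.lastCases with
      | last => simpa using hv i
      | cast j => simpa using h.comm i j

variable {χ : Fin (n + 1) → G →* Kˣ} {Q : Fin (n + 1) → Fin (n + 1) → Kˣ}
  {κ : Fin (n + 1) → Fin (n + 1) → MonoidAlgebra K G}
  {b : Module.Basis (Fin (n + 1)) K V} {ρ : Representation K G V}
  {b' : Module.Basis (Fin n) K V'} {ρ' : Representation K G V'}

/-- A twisted derivation of a model with linearly independent monomials allows to adjoin a last
generator. -/
theorem linearIndependent_monomial_of_twistedDerivation {A : Type*} [Ring A] [Algebra K A]
    {v : Fin n → A} {t : G → A} (hQ : IsQuantumSystem Q) (hκ : IsQuantumTwoForm Q κ)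
    (hχ : ∀ g i, ρ g (b i) = (χ i g : K) • b i)
    (hA : IsModel (fun i : Fin n => χ i.castSucc) (fun i j => Q i.castSucc j.castSucc)
      (fun i j => κ i.castSucc j.castSucc) v t)
    (hli : LinearIndependent K (mon v t)) (σ δ : A →ₗ[K] A)
    (σm : ∀ x y, σ (x * y) = σ x * σ y) (δm : ∀ x y, δ (x * y) = σ x * δ y + δ x * y)
    (σv : ∀ i, σ (v i) = (Q i.castSucc (Fin.last n) : K) • v i)
    (δv : ∀ i, δ (v i) = ∑ g, (κ i.castSucc (Fin.last n)).coeff g • t g)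
    (σt : ∀ g, σ (t g) = (((χ (Fin.last n) g)⁻¹ : Kˣ) : K) • t g) (δt : ∀ g, δ (t g) = 0) :
    LinearIndependent K (H.monomial b ρ Q κ) := by
  -- `Finsupp.single k a` stands for `a x^k` in the Ore extension, and `X` is left multiplication by
  -- `x`.
  let X : Module.End K (ℕ →₀ A) := Finsupp.lsum K fun k =>
    Finsupp.lsingle (k + 1) ∘ₗ σ + Finsupp.lsingle k ∘ₗ δ
  let L : A →ₐ[K] Module.End K (ℕ →₀ A) := Algebra.lsmul K K (ℕ →₀ A)
  have hX (k : ℕ) (a : A) : X (Finsupp.single k a) =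
      Finsupp.single (k + 1) (σ a) + Finsupp.single k (δ a) := by simp [X]
  have hL (k : ℕ) (a c : A) : L a (Finsupp.single k c) = Finsupp.single k (a * c) := by simp [L]
  have hXL (a : A) : X * L a = L (σ a) * X + L (δ a) := by
    refine Finsupp.lhom_ext fun k c => ?_
    simp only [Module.End.mul_apply, LinearMap.add_apply, hL, hX, σm, δm, map_add,
      Finsupp.single_add, add_assoc]
  have hmodel := (hA.map L).snoc hQ hκ X
    (fun i => by rw [hXL, σv, δv]; simp only [map_smul, map_sum, smul_mul_assoc])
    (fun g => by rw [hXL, σt, δt]; simp only [map_smul, map_zero, add_zero, smul_mul_assoc])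
  -- Monomials end in `t_g`, whereas coefficients stand to the left of `x^k`. As `δ` kills `t_g`,
  -- the exchange only costs a unit.
  have hXk (k : ℕ) (g : G) : (X ^ k) (Finsupp.single 0 (t g)) =
      Finsupp.single k (((χ (Fin.last n) g)⁻¹ ^ k : Kˣ) • t g) := by
    induction k with
    | zero => simp
    | succ k ih =>
      rw [pow_succ', Module.End.mul_apply, ih, hX, pow_succ, Units.smul_def, Units.smul_def,
        map_smul, map_smul, σt, δt, smul_zero, Finsupp.single_zero, add_zero, smul_smul,
        Units.val_mul]
  refine linearIndependent_monomial hχ hmodel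
    (LinearMap.applyₗ (Finsupp.single 0 (1 : A)) : Module.End K (ℕ →₀ A) →ₗ[K] _) ?_
  have hmain : (fun x : (Fin (n + 1) → ℕ) × G => LinearMap.applyₗ (Finsupp.single 0 (1 : A))
        (mon (Fin.snoc (α := fun _ => Module.End K (ℕ →₀ A)) (fun i => L (v i)) X)
          (fun g => L (t g)) x)) =
      fun x => Finsupp.single (x.1 (Fin.last n))
        (((χ (Fin.last n) x.2)⁻¹ ^ x.1 (Fin.last n) : Kˣ) •
          mon v t (fun i => x.1 i.castSucc, x.2)) := by
    funext x
    have hprod : (List.ofFn fun i : Fin n => L (v i) ^ x.1 i.castSucc).prod =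
        L (List.ofFn fun i : Fin n => v i ^ x.1 i.castSucc).prod := by
      rw [map_list_prod, List.map_ofFn]
      congr 2
      funext i
      simp
    rw [mon_succ]
    simp only [Fin.snoc_castSucc, Fin.snoc_last, hprod, LinearMap.applyₗ_apply_apply,
      Module.End.mul_apply, hL, mul_one, hXk]
    rw [mul_smul_comm]
    rfl
  rw [hmain]
  -- In each degree `k` the monomials of `A`, rescaled by units, stay independent; different degrees
  -- do not interact.
  have := Finsupp.linearIndependent_single (R := K) (ι := ℕ)
    (fun (k : ℕ) (x : (Fin n → ℕ) × G) => ((χ (Fin.last n) x.2)⁻¹ ^ k : Kˣ) • mon v t x)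
    (fun k => hli.units_smul fun x => (χ (Fin.last n) x.2)⁻¹ ^ k)
  refine this.comp
    (fun x : (Fin (n + 1) → ℕ) × G => ⟨x.1 (Fin.last n), (fun i => x.1 i.castSucc, x.2)⟩) ?_
  rintro ⟨α, g⟩ ⟨β, h⟩ heq
  simp only [Sigma.mk.injEq, heq_eq_eq, Prod.mk.injEq] at heq
  obtain ⟨h1, h2, rfl⟩ := heq
  rw [Prod.mk.injEq]
  refine ⟨funext fun i => ?_, rfl⟩
  induction i using Fin.lastCases with
  | last => exact h1
  | cast i => exact congrFun h2 i

theorem linearIndependent_monomial_succ (hadm : Admissible χ Q κ)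
    (hχ : ∀ g i, ρ g (b i) = (χ i g : K) • b i)
    (hχ' : ∀ g i, ρ' g (b' i) = (χ i.castSucc g : K) • b' i)
    (hli : LinearIndependent K (H.monomial b' ρ' (fun i j => Q i.castSucc j.castSucc)
      (fun i j => κ i.castSucc j.castSucc))) :
    LinearIndependent K (H.monomial b ρ Q κ) := by
  obtain ⟨σ, δ, -, -, σm, δm, σv, δv, σt, δt⟩ := exists_twistedDerivation hadm hχ'
  exact linearIndependent_monomial_of_twistedDerivation hadm.system hadm.form hχ (isModel_H hχ')
    hli σ δ σm δm σv δv σt δt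

/-- The products `f(a) x^k`, with `a` in the smaller algebra and `x` the last generator, have the
same span as the monomials. That span is stable under left multiplication by the generators, because
`x f(a) = f(σ a) x + f(δ a)`. -/
theorem span_monomial_succ (hadm : Admissible χ Q κ)
    (hχ : ∀ g i, ρ g (b i) = (χ i g : K) • b i)
    (hχ' : ∀ g i, ρ' g (b' i) = (χ i.castSucc g : K) • b' i)
    (hspan : Submodule.span K (Set.range (H.monomial b' ρ' (fun i j => Q i.castSucc j.castSucc)
      (fun i j => κ i.castSucc j.castSucc))) = ⊤) :
    Submodule.span K (Set.range (H.monomial b ρ Q κ)) = ⊤ := by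
  obtain ⟨σ, δ, σ1, δ1, σm, δm, σv, δv, σt, δt⟩ := exists_twistedDerivation hadm hχ'
  have hH := isModel_H (Q := Q) (κ := κ) hχ
  obtain ⟨f, fv, ft⟩ := hH.castSucc.exists_lift hχ'
  have hx (a) : H.v b ρ Q κ (Fin.last n) * f a = f (σ a) * H.v b ρ Q κ (Fin.last n) + f (δ a) := by
    induction a using H.induction with
    | hs a => simp [Algebra.algebraMap_eq_smul_one, σ1, δ1]
    | hv i =>
      rw [σv, δv, fv, hH.comm, map_smul, fv, smul_mul_assoc]
      simp only [map_sum, map_smul, ft]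
    | ht g =>
      rw [σt, δt, map_zero, add_zero, map_smul, ft, smul_mul_assoc, hH.act, smul_smul]
      simp
    | hadd x y hx hy =>
      simp only [map_add, mul_add, add_mul, hx, hy]
      abel
    | hmul x y hx hy =>
      rw [σm, δm, map_mul, ← mul_assoc, hx, add_mul, mul_assoc, hy, map_add, map_mul, map_mul,
        map_mul, mul_add, mul_assoc, add_assoc]
  have hmon (x : (Fin (n + 1) → ℕ) × G) :
      f (H.monomial b' ρ' _ _ (fun i => x.1 i.castSucc, x.2)) *
          H.v b ρ Q κ (Fin.last n) ^ x.1 (Fin.last n) =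
        (χ (Fin.last n) x.2 ^ x.1 (Fin.last n) : Kˣ) • H.monomial b ρ Q κ x := by
    rw [H.monomial_eq, H.monomial_eq, map_mon, mon_succ]
    simp only [fv, ft, mon]
    rw [mul_assoc, hH.t_mul_v_pow, mul_smul_comm, mul_assoc, Units.smul_def, Units.val_pow_eq_pow_val]
  have hmem (k : ℕ) (a) : f a * H.v b ρ Q κ (Fin.last n) ^ k ∈
      Submodule.span K (Set.range (H.monomial b ρ Q κ)) := by
    have ha := hspan.ge (Submodule.mem_top (x := a))
    induction ha using Submodule.span_induction with
    | mem a ha =>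
      obtain ⟨⟨α, g⟩, rfl⟩ := ha
      have := hmon (Fin.snoc (α := fun _ => ℕ) α k, g)
      simp only [Fin.snoc_castSucc, Fin.snoc_last] at this
      rw [this]
      exact Submodule.smul_mem _ _ (Submodule.subset_span ⟨_, rfl⟩)
    | zero => simp
    | add x y _ _ hx hy => rw [map_add, add_mul]; exact Submodule.add_mem _ hx hy
    | smul c x _ hx => rw [map_smul, smul_mul_assoc]; exact Submodule.smul_mem _ c hx
  have hstable (y : H b ρ Q κ)
      (hy : ∀ k a, y * (f a * H.v b ρ Q κ (Fin.last n) ^ k) ∈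
        Submodule.span K (Set.range (H.monomial b ρ Q κ))) :
      ∀ x ∈ Submodule.span K (Set.range (H.monomial b ρ Q κ)),
        y * x ∈ Submodule.span K (Set.range (H.monomial b ρ Q κ)) := by
    intro x hx
    induction hx using Submodule.span_induction with
    | mem x hx =>
      obtain ⟨x, rfl⟩ := hx
      rw [← inv_smul_smul (χ (Fin.last n) x.2 ^ x.1 (Fin.last n)) (H.monomial b ρ Q κ x), ← hmon,
        Units.smul_def, mul_smul_comm]
      exact Submodule.smul_mem _ _ (hy _ _)
    | zero => simp
    | add x y _ _ hx hy => rw [mul_add]; exact Submodule.add_mem _ hx hy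
    | smul c x _ hx => rw [mul_smul_comm]; exact Submodule.smul_mem _ c hx
  refine H.eq_top_of_stable _ ?_ (fun i => hstable _ fun k a => ?_) (fun g => hstable _ fun k a => ?_)
  · simpa using hmem 0 1
  · induction i using Fin.lastCases with
    | last =>
      rw [← mul_assoc, hx, add_mul, mul_assoc, ← pow_succ']
      exact Submodule.add_mem _ (hmem _ _) (hmem _ _)
    | cast i =>
      rw [← fv, ← mul_assoc, ← map_mul]
      exact hmem _ _
  · rw [← ft, ← mul_assoc, ← map_mul]
    exact hmem _ _

end Step

/-! ### The case without generators, and the induction -/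

section

variable {K V G : Type*} [Field K] [AddCommGroup V] [Module K V]

theorem isQuantumDrinfeldHecke_zero [Group G] [Fintype G] (b : Module.Basis (Fin 0) K V)
    (ρ : Representation K G V) (Q : Fin 0 → Fin 0 → Kˣ)
    (κ : Fin 0 → Fin 0 → MonoidAlgebra K G) : IsQuantumDrinfeldHecke b ρ Q κ := by
  have hχ : ∀ (g : G) (i : Fin 0), ρ g (b i) = ((Fin.elim0 i : G →* Kˣ) g : K) • b i :=
    fun _ i => i.elim0
  have hH := isModel_H (Q := Q) (κ := κ) hχ
  constructor
  -- Without generators the group algebra itself is a model, and its standard basis separates the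
  -- `t_g`.
  · have hmodel : IsModel (fun i => (Fin.elim0 i : G →* Kˣ)) Q κ
        (fun i => (Fin.elim0 i : MonoidAlgebra K G)) (fun g => MonoidAlgebra.single g (1 : K)) :=
      { one := rfl
        mul := fun g h => by simp [MonoidAlgebra.single_mul_single]
        act := fun _ i => i.elim0
        comm := fun i => i.elim0 }
    refine linearIndependent_monomial hχ hmodel
      (MonoidAlgebra.coeffLinearEquiv K).toLinearMap ?_
    have := (Finsupp.basisSingleOne (R := K) (ι := G)).linearIndependent.comp
      (fun x : (Fin 0 → ℕ) × G => x.2) (fun x y h => Prod.ext (Subsingleton.elim _ _) h)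
    have heq : (fun x : (Fin 0 → ℕ) × G => (MonoidAlgebra.coeffLinearEquiv K).toLinearMap
        (mon (fun i => (Fin.elim0 i : MonoidAlgebra K G))
          (fun g => MonoidAlgebra.single g (1 : K)) x)) =
        Finsupp.basisSingleOne ∘ fun x : (Fin 0 → ℕ) × G => x.2 := by
      funext x
      simp [mon]
    rw [heq]
    exact this
  · have hmon (x : (Fin 0 → ℕ) × G) : H.monomial b ρ Q κ x = H.t b ρ Q κ x.2 := by
      simp [H.monomial]
    refine H.eq_top_of_stable _ (Submodule.subset_span ⟨(0, 1), ?_⟩) (fun i => i.elim0) ?_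
    · rw [hmon, hH.one]
    · intro g x hx
      induction hx using Submodule.span_induction with
      | mem x hx =>
        obtain ⟨x, rfl⟩ := hx
        refine Submodule.subset_span ⟨(0, g * x.2), ?_⟩
        rw [hmon, hmon, hH.mul]
      | zero => simp
      | add x y _ _ hx hy => rw [mul_add]; exact Submodule.add_mem _ hx hy
      | smul c x _ hx => rw [mul_smul_comm]; exact Submodule.smul_mem _ c hx

/-- The diagonal representation on `Kⁿ` with characters `χ_i`. -/
def diagRep [Group G] {n : ℕ} (χ : Fin n → G →* Kˣ) : Representation K G (Fin n → K) where
  toFun g := LinearMap.pi fun i => (χ i g : K) • LinearMap.proj i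
  map_one' := by ext; simp
  map_mul' g h := by
    refine LinearMap.ext fun x => funext fun i => ?_
    simp [mul_assoc]

theorem diagRep_basisFun [Group G] {n : ℕ} (χ : Fin n → G →* Kˣ) (g : G) (i : Fin n) :
    diagRep χ g (Pi.basisFun K (Fin n) i) = (χ i g : K) • Pi.basisFun K (Fin n) i := by
  funext j
  by_cases h : j = i
  · subst h; simp [diagRep]
  · simp [diagRep, h]

variable [CommGroup G] [Fintype G]

/-- Dropping the last generator requires a smaller representation; the coordinate spaces `Kⁿ`
provide one for every `n`. An arbitrary `V` only enters in the last step of the induction. -/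
theorem Admissible.isQuantumDrinfeldHecke_diagRep : ∀ {n : ℕ} {χ : Fin n → G →* Kˣ}
    {Q : Fin n → Fin n → Kˣ} {κ : Fin n → Fin n → MonoidAlgebra K G}, Admissible χ Q κ →
    IsQuantumDrinfeldHecke (Pi.basisFun K (Fin n)) (diagRep χ) Q κ
  | 0, _, _, _, _ => isQuantumDrinfeldHecke_zero _ _ _ _
  | _ + 1, χ, _, _, h =>
    have ih := h.castSucc.isQuantumDrinfeldHecke_diagRep
    ⟨linearIndependent_monomial_succ h (diagRep_basisFun χ) (diagRep_basisFun _) ih.1,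
      span_monomial_succ h (diagRep_basisFun χ) (diagRep_basisFun _) ih.2⟩

theorem Admissible.isQuantumDrinfeldHecke {n : ℕ} {χ : Fin n → G →* Kˣ}
    {Q : Fin n → Fin n → Kˣ} {κ : Fin n → Fin n → MonoidAlgebra K G} (h : Admissible χ Q κ)
    {b : Module.Basis (Fin n) K V} {ρ : Representation K G V}
    (hχ : ∀ g i, ρ g (b i) = (χ i g : K) • b i) : IsQuantumDrinfeldHecke b ρ Q κ := by
  cases n with
  | zero => exact isQuantumDrinfeldHecke_zero _ _ _ _
  | succ n =>
    have ih := h.castSucc.isQuantumDrinfeldHecke_diagRep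
    exact ⟨linearIndependent_monomial_succ h hχ (diagRep_basisFun _) ih.1,
      span_monomial_succ h hχ (diagRep_basisFun _) ih.2⟩

end

end

end QuantumDrinfeldHecke
namespace QuantumDrinfeldHecke

noncomputable section

/-! ### The monomial basis forces the conditions on `Q` and `κ` -/

theorem prod_ofFn_eq_one {M : Type*} [Monoid M] {n : ℕ} {f : Fin n → M} (h : ∀ i, f i = 1) :
    (List.ofFn f).prod = 1 :=
  List.prod_eq_one fun x hx => by
    obtain ⟨i, rfl⟩ := List.mem_ofFn.1 hx
    exact h i

theorem prod_ofFn_eq_single {M : Type*} [Monoid M] : ∀ {n : ℕ} {f : Fin n → M} (i : Fin n),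
    (∀ j, j ≠ i → f j = 1) → (List.ofFn f).prod = f i
  | n + 1, f, i, h => by
    rw [List.ofFn_succ, List.prod_cons]
    induction i using Fin.cases with
    | zero => rw [prod_ofFn_eq_one fun i => h _ (Fin.succ_ne_zero i), mul_one]
    | succ i =>
      rw [h 0 (Fin.succ_ne_zero i).symm, one_mul]
      exact prod_ofFn_eq_single (f := fun i => f i.succ) i fun j hj => h _ (by simpa using hj)

theorem prod_ofFn_eq_pair {M : Type*} [Monoid M] : ∀ {n : ℕ} {f : Fin n → M} {i j : Fin n},
    i < j → (∀ k, k ≠ i → k ≠ j → f k = 1) → (List.ofFn f).prod = f i * f j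
  | n + 1, f, i, j, hij, h => by
    rw [List.ofFn_succ, List.prod_cons]
    obtain ⟨j, rfl⟩ := Fin.exists_succ_eq.2 (Fin.ne_zero_of_lt hij)
    induction i using Fin.cases with
    | zero =>
      congr 1
      exact prod_ofFn_eq_single (f := fun i => f i.succ) j
        fun k hk => h _ (Fin.succ_ne_zero k) (by simpa using hk)
    | succ i =>
      rw [h 0 (Fin.succ_ne_zero i).symm (Fin.succ_ne_zero j).symm, one_mul]
      exact prod_ofFn_eq_pair (f := fun i => f i.succ) (by simpa using hij)
        fun k hki hkj => h _ (by simpa using hki) (by simpa using hkj)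

section

variable {G A : Type*} [Monoid A] {n : ℕ} (v : Fin n → A) (t : G → A)

theorem mon_zero (g : G) : mon v t (0, g) = t g := by
  rw [mon, prod_ofFn_eq_one fun i => by simp, one_mul]

theorem mon_single (i : Fin n) (k : ℕ) (g : G) : mon v t (Pi.single i k, g) = v i ^ k * t g := by
  rw [mon, prod_ofFn_eq_single i fun j hj => by simp [hj]]
  simp

theorem mon_pair {i j : Fin n} (hij : i < j) (g : G) :
    mon v t (Pi.single i 1 + Pi.single j 1, g) = v i * v j * t g := by
  rw [mon, prod_ofFn_eq_pair hij fun k hki hkj => by simp [hki, hkj]]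
  simp [hij.ne, hij.ne']

end

section

variable {K G A : Type*} [Field K] {n : ℕ} [Ring A] [Algebra K A] {v : Fin n → A} {t : G → A}

open Classical in
-- Coefficient extraction without assuming that the monomials span: the coordinate functional on
-- their span extends to `A` over a field.
theorem exists_coord (hli : LinearIndependent K (mon v t)) (x : (Fin n → ℕ) × G) :
    ∃ e : A →ₗ[K] K, ∀ y, e (mon v t y) = if y = x then 1 else 0 := by
  obtain ⟨e, he⟩ := LinearMap.exists_extend
    ((Module.Basis.span hli).coord x)
  refine ⟨e, fun y => ?_⟩
  have h1 : e (mon v t y) = (e ∘ₗ (Submodule.span K (Set.range (mon v t))).subtype)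
      (Module.Basis.span hli y) := by
    simp [Module.Basis.span_apply]
  rw [h1, he]
  simp [Finsupp.single_apply]

variable [Fintype G]

open Classical in
theorem coord_sum_t {x : (Fin n → ℕ) × G} {e : A →ₗ[K] K}
    (he : ∀ y, e (mon v t y) = if y = x then 1 else 0) (c : G → K) :
    e (∑ g, c g • t g) = if x.1 = 0 then c x.2 else 0 := by
  have ht (g : G) : e (t g) = if (0, g) = x then 1 else 0 := by rw [← he, mon_zero]
  obtain ⟨α, g⟩ := x
  simp only [map_sum, map_smul, ht, Prod.mk.injEq]
  by_cases hα : α = 0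
  · simp [hα]
  · simp [hα, Ne.symm hα]

open Classical in
theorem coord_v_mul_sum_t {x : (Fin n → ℕ) × G} {e : A →ₗ[K] K}
    (he : ∀ y, e (mon v t y) = if y = x then 1 else 0) (i : Fin n) (c : G → K) :
    e (v i * ∑ g, c g • t g) = if x.1 = Pi.single i 1 then c x.2 else 0 := by
  have ht (g : G) : e (v i * t g) = if (Pi.single i 1, g) = x then 1 else 0 := by
    rw [← he, mon_single, pow_one]
  obtain ⟨α, g⟩ := x
  simp only [Finset.mul_sum, mul_smul_comm, map_sum, map_smul, ht, Prod.mk.injEq]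
  by_cases hα : α = Pi.single i 1
  · simp [hα]
  · simp [hα, Ne.symm hα]

variable {V : Type*} [AddCommGroup V] [Module K V] [CommGroup G] {χ : Fin n → G →* Kˣ}
  {Q : Fin n → Fin n → Kˣ} {κ : Fin n → Fin n → MonoidAlgebra K G}

theorem IsModel.sum_t_mul_v (h : IsModel χ Q κ v t) (i : Fin n) (c : G → K) :
    (∑ g, c g • t g) * v i = v i * ∑ g, (c g * χ i g) • t g := by
  simp only [Finset.sum_mul, Finset.mul_sum, smul_mul_assoc, mul_smul_comm, h.act, smul_smul]

theorem IsModel.diag_of_linearIndependent (h : IsModel χ Q κ v t)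
    (hli : LinearIndependent K (mon v t)) (i : Fin n) : Q i i = 1 ∧ κ i i = 0 := by
  classical
  have key := h.comm i i
  have h2 : v i * v i = mon v t (Pi.single i 2, 1) := by rw [mon_single, h.one, mul_one, pow_two]
  constructor
  · obtain ⟨e, he⟩ := exists_coord hli (Pi.single i 2, 1)
    have := congrArg e key
    rw [h2, map_add, map_smul, he, coord_sum_t he] at this
    ext
    simpa using this.symm
  · ext g
    obtain ⟨e, he⟩ := exists_coord hli (0, g)
    have := congrArg e key
    rw [h2, map_add, map_smul, he, coord_sum_t he] at this
    simpa using this.symm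

/-- Swapping twice gives `v_i v_j = q_{ji} q_{ij} v_i v_j + q_{ji} κ(v_i, v_j) + κ(v_j, v_i)`;
compare coefficients of `v_i v_j` and of each `t_g`. -/
theorem IsModel.lt_of_linearIndependent (h : IsModel χ Q κ v t)
    (hli : LinearIndependent K (mon v t)) {i j : Fin n} (hij : i < j) :
    Q j i * Q i j = 1 ∧ κ j i = -((Q j i : K) • κ i j) := by
  classical
  have key := h.comm j i
  rw [h.comm i j, smul_add, smul_smul] at key
  have h2 : v i * v j = mon v t (Pi.single i 1 + Pi.single j 1, 1) := by
    rw [mon_pair _ _ hij, h.one, mul_one]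
  have hne : (Pi.single i 1 + Pi.single j 1 : Fin n → ℕ) ≠ 0 := fun h0 => by
    simpa using congrFun h0 i
  constructor
  · obtain ⟨e, he⟩ := exists_coord hli (Pi.single i 1 + Pi.single j 1, 1)
    have := congrArg e key
    rw [h2, map_add, map_add, map_smul, map_smul, he, coord_sum_t he, coord_sum_t he] at this
    ext
    simpa [hne] using this.symm
  · ext g
    obtain ⟨e, he⟩ := exists_coord hli (0, g)
    have := congrArg e key
    rw [h2, map_add, map_add, map_smul, map_smul, he, coord_sum_t he, coord_sum_t he] at this
    simp [hne] at this
    simp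
    linear_combination -this

/-- Conjugation by `t_x` scales both `v_j v_i` and `v_i v_j` by `χ_j(x) χ_i(x)` but fixes `κ(v_i,
v_j)`, since `G` is abelian. -/
theorem IsModel.inverse_of_linearIndependent (h : IsModel χ Q κ v t)
    (hli : LinearIndependent K (mon v t)) {g : G} {i j : Fin n} (hg : (κ i j).coeff g ≠ 0) (x : G) :
    χ i x = (χ j x)⁻¹ := by
  classical
  have e1 : t x * (v j * v i) = ((χ j x : K) * χ i x) • (v j * v i * t x) := by
    rw [← mul_assoc, h.act, smul_mul_assoc, mul_assoc, h.act, mul_smul_comm, smul_smul, mul_assoc]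
  have e2 : t x * (v i * v j) = ((χ j x : K) * χ i x) • (v i * v j * t x) := by
    rw [← mul_assoc, h.act, smul_mul_assoc, mul_assoc, h.act, mul_smul_comm, smul_smul, mul_assoc,
      mul_comm (χ i x : K)]
  rw [h.comm i j, mul_add, mul_smul_comm, e2, t_mul_sum_smul_t h, add_mul, smul_add, smul_mul_assoc,
    smul_comm, add_right_inj] at e1
  have e3 := congrArg (· * t x⁻¹) e1
  simp only [smul_mul_assoc, mul_assoc, h.mul, mul_inv_cancel, h.one, mul_one] at e3
  obtain ⟨e, he⟩ := exists_coord hli (0, g)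
  have := congrArg e e3
  rw [map_smul, coord_sum_t he] at this
  simp only [if_true, smul_eq_mul] at this
  have h1 : (χ j x : K) * χ i x = 1 := mul_right_cancel₀ hg (by rw [← this, one_mul])
  rw [eq_inv_iff_mul_eq_one]
  ext
  rw [Units.val_mul, mul_comm, h1, Units.val_one]

theorem IsModel.char_of_linearIndependent (h : IsModel χ Q κ v t)
    (hli : LinearIndependent K (mon v t)) {g : G} {i j k : Fin n} (hki : k ≠ i)
    (hkj : k ≠ j) (hg : (κ i j).coeff g ≠ 0) : Q j k * Q i k * χ k g = 1 := by
  classical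
  obtain ⟨e, he⟩ := exists_coord hli (Pi.single k 1, g)
  have hne {l m : Fin n} (hlm : l ≠ m) : (Pi.single l 1 : Fin n → ℕ) ≠ Pi.single m 1 := fun h0 => by
    simpa [hlm] using congrFun h0 l
  -- Two bracketings of `v_k v_j v_i` are compared at `v_k t_g`. The cubic terms have equal
  -- coefficients and cancel, so `v_i v_j v_k` need not be an ordered monomial; the terms starting
  -- with `v_i` or `v_j` do not contribute.
  have e1 : v k * (v j * v i) = ((Q i j : K) * Q i k * Q j k) • (v i * (v j * v k)) +
      ((Q i j : K) * Q i k) • (v i * ∑ g, (κ j k).coeff g • t g) +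
      (Q i j : K) • (v j * ∑ g, ((κ i k).coeff g * χ j g) • t g) +
      v k * ∑ g, (κ i j).coeff g • t g := by
    rw [h.comm i j, mul_add, mul_smul_comm, ← mul_assoc, h.comm i k, add_mul, smul_mul_assoc,
      mul_assoc, h.comm j k, mul_add, mul_smul_comm, h.sum_t_mul_v]
    simp only [smul_add, smul_smul, mul_assoc]
  have e2 : v k * v j * v i = ((Q j k : K) * Q i k * Q i j) • (v i * (v j * v k)) +
      ((Q j k : K) * Q i k) • (v k * ∑ g, ((κ i j).coeff g * χ k g) • t g) +
      (Q j k : K) • (v j * ∑ g, (κ i k).coeff g • t g) +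
      v i * ∑ g, ((κ j k).coeff g * χ i g) • t g := by
    rw [h.comm j k, add_mul, smul_mul_assoc, mul_assoc, h.comm i k, mul_add, mul_smul_comm,
      ← mul_assoc, h.comm i j, add_mul, smul_mul_assoc, h.sum_t_mul_v, h.sum_t_mul_v]
    simp only [smul_add, smul_smul, mul_assoc]
  have key := congrArg e (e2.symm.trans ((mul_assoc _ _ _).trans e1))
  simp only [map_add, map_smul, coord_v_mul_sum_t he, if_neg (hne hki), if_neg (hne hkj),
    if_true, smul_eq_mul, mul_zero, add_zero] at key
  ext
  refine mul_right_cancel₀ hg ?_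
  push_cast
  linear_combination key

theorem IsModel.admissible_of_linearIndependent (h : IsModel χ Q κ v t)
    (hli : LinearIndependent K (mon v t)) : Admissible χ Q κ := by
  have hsys (i j : Fin n) : Q i j = (Q j i)⁻¹ := by
    rcases lt_trichotomy i j with hij | rfl | hij
    · exact eq_inv_of_mul_eq_one_right (h.lt_of_linearIndependent hli hij).1
    · rw [(h.diag_of_linearIndependent hli i).1, inv_one]
    · exact eq_inv_of_mul_eq_one_left (h.lt_of_linearIndependent hli hij).1
  refine ⟨fun i j => ⟨hsys i j, (h.diag_of_linearIndependent hli i).1⟩,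
    fun i j => ⟨(h.diag_of_linearIndependent hli i).2, ?_⟩,
    fun g i j _ hg => h.inverse_of_linearIndependent hli hg,
    fun g i j _ hg k hki hkj => ?_⟩
  · rw [← hsys j i]
    rcases lt_trichotomy i j with hij | rfl | hij
    · exact (h.lt_of_linearIndependent hli hij).2
    · rw [(h.diag_of_linearIndependent hli i).2, smul_zero, neg_zero]
    · rw [(h.lt_of_linearIndependent hli hij).2, smul_neg, neg_neg, smul_smul, ← Units.val_mul,
        hsys i j, mul_inv_cancel, Units.val_one, one_smul]
  · rw [hsys k i, hsys k j, ← mul_inv, mul_comm (Q i k)]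
    exact eq_inv_of_mul_eq_one_right (h.char_of_linearIndependent hli hki hkj hg)

theorem isQuantumDrinfeldHecke_iff_admissible {b : Module.Basis (Fin n) K V}
    {ρ : Representation K G V} (hχ : ∀ g i, ρ g (b i) = (χ i g : K) • b i) :
    IsQuantumDrinfeldHecke b ρ Q κ ↔ Admissible χ Q κ :=
  ⟨fun h => (isModel_H hχ).admissible_of_linearIndependent h.1,
    fun h => h.isQuantumDrinfeldHecke hχ⟩

end

end

end QuantumDrinfeldHecke
namespace QuantumDrinfeldHecke

noncomputable section

/-! ### The factor algebras of the skew group algebra -/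

section

variable {K V G : Type*} [Field K] [AddCommGroup V] [Module K V] [Group G] {n : ℕ}
  {ρ : Representation K G V} {b : Module.Basis (Fin n) K V}

theorem Tensor.induction {p : Tensor ρ → Prop} (hs : ∀ a : K, p (algebraMap K _ a))
    (hι : ∀ v, p (Tensor.ι ρ v)) (hmul : ∀ x y, p x → p y → p (x * y))
    (hadd : ∀ x y, p x → p y → p (x + y)) (x : Tensor ρ) : p x :=
  TensorAlgebra.induction hs hι hmul hadd x

theorem Tensor.exists_lift {A : Type*} [Ring A] [Algebra K A] (f : V →ₗ[K] A) :
    ∃ F : Tensor ρ →ₐ[K] A, ∀ v, F (Tensor.ι ρ v) = f v :=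
  ⟨TensorAlgebra.lift K f, TensorAlgebra.lift_ι_apply f⟩

theorem skewT_one : skewT ρ 1 = 1 := rfl

theorem skewT_mul (g h : G) : skewT ρ g * skewT ρ h = skewT ρ (g * h) := by
  rw [skewT, skewT, skewT, SkewMonoidAlgebra.single_mul_single, smul_one, one_mul]

theorem skewVec_smul (a : K) (v : V) : skewVec ρ (a • v) = a • skewVec ρ v := by
  rw [skewVec, skewVec, map_smul, SkewMonoidAlgebra.smul_single]

theorem skewT_mul_skewVec (g : G) (v : V) :
    skewT ρ g * skewVec ρ v = skewVec ρ (ρ g v) * skewT ρ g := by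
  rw [skewT, skewVec, skewVec, SkewMonoidAlgebra.single_mul_single,
    SkewMonoidAlgebra.single_mul_single, one_mul, mul_one, one_smul, mul_one, one_mul,
    Tensor.smul_def, Tensor.act_ι]

theorem skew_hom_ext {A : Type*} [Ring A] [Algebra K A] {f f' : Skew ρ →ₐ[K] A}
    (hv : ∀ i, f (skewVec ρ (b i)) = f' (skewVec ρ (b i)))
    (ht : ∀ g, f (skewT ρ g) = f' (skewT ρ g)) : f = f' := by
  have hvec (v : V) : f (skewVec ρ v) = f' (skewVec ρ v) := by
    let ψ : V →ₗ[K] Skew ρ :=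
      { toFun := skewVec ρ
        map_add' := fun x y => by
          rw [skewVec, skewVec, skewVec, map_add, SkewMonoidAlgebra.single_add]
        map_smul' := skewVec_smul }
    have : f.toLinearMap ∘ₗ ψ = f'.toLinearMap ∘ₗ ψ := b.ext hv
    exact LinearMap.congr_fun this v
  have hone (x : Tensor ρ) : f (SkewMonoidAlgebra.single 1 x) =
      f' (SkewMonoidAlgebra.single 1 x) := by
    induction x using Tensor.induction with
    | hs a =>
      have : SkewMonoidAlgebra.single (1 : G) (algebraMap K (Tensor ρ) a) =
        algebraMap K (Skew ρ) a := rfl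
      rw [this, AlgHom.commutes, AlgHom.commutes]
    | hι v => exact hvec v
    | hmul x y hx hy =>
      have : SkewMonoidAlgebra.single (1 : G) (x * y) =
          SkewMonoidAlgebra.single (1 : G) x * SkewMonoidAlgebra.single (1 : G) y := by
        rw [SkewMonoidAlgebra.single_mul_single, one_smul, one_mul]
      rw [this, map_mul, map_mul, hx, hy]
    | hadd x y hx hy => rw [SkewMonoidAlgebra.single_add, map_add, map_add, hx, hy]
  refine AlgHom.ext fun x => ?_
  induction x using SkewMonoidAlgebra.induction_on with
  | zero => rw [map_zero, map_zero]
  | single g x =>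
    have : SkewMonoidAlgebra.single g x = SkewMonoidAlgebra.single (1 : G) x * skewT ρ g := by
      rw [skewT, SkewMonoidAlgebra.single_mul_single, one_smul, one_mul, mul_one]
    rw [this, map_mul, map_mul, hone, ht]
  | add x y hx hy => rw [map_add, map_add, hx, hy]

variable [Fintype G] {χ : Fin n → G →* Kˣ} {Q : Fin n → Fin n → Kˣ}
  {κ : Fin n → Fin n → MonoidAlgebra K G}

/-- A map out of `T(V) # G` is a map of `T(V)` and a map of `G` that are compatible with the action;
compatibility propagates from `V` to products and sums. -/
theorem IsModel.exists_skew_lift {A : Type*} [Ring A] [Algebra K A] {v : Fin n → A} {t : G → A}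
    (h : IsModel χ Q κ v t) (hχ : ∀ g i, ρ g (b i) = (χ i g : K) • b i) :
    ∃ f : Skew ρ →ₐ[K] A, (∀ i, f (skewVec ρ (b i)) = v i) ∧ ∀ g, f (skewT ρ g) = t g := by
  obtain ⟨F, hF⟩ := Tensor.exists_lift (ρ := ρ) (b.constr K v)
  let T : G →* A :=
    { toFun := t
      map_one' := h.one
      map_mul' := fun g g' => (h.mul g g').symm }
  have hcomm : ∀ {x : Tensor ρ} {g : G}, F (g • x) * T g = T g * F x := by
    intro x g
    induction x using Tensor.induction with
    | hs a =>
      rw [Tensor.smul_def, AlgHom.commutes, AlgHom.commutes]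
      exact Algebra.commutes a _
    | hι w =>
      rw [Tensor.smul_def, Tensor.act_ι, hF, hF]
      have : LinearMap.mulRight K (t g) ∘ₗ b.constr K v ∘ₗ ρ g =
          LinearMap.mulLeft K (t g) ∘ₗ b.constr K v := by
        refine b.ext fun i => ?_
        simp [hχ, h.act]
      exact LinearMap.congr_fun this w
    | hmul x y hx hy =>
      rw [smul_mul', map_mul, map_mul, mul_assoc, hy, ← mul_assoc, hx, mul_assoc]
    | hadd x y hx hy => rw [smul_add, map_add, map_add, add_mul, mul_add, hx, hy]
  have hsingle (g : G) (x : Tensor ρ) :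
      SkewMonoidAlgebra.liftNCAlgHom F T hcomm (SkewMonoidAlgebra.single g x) = F x * T g :=
    SkewMonoidAlgebra.liftNC_single _ _ _ _
  refine ⟨SkewMonoidAlgebra.liftNCAlgHom F T hcomm, fun i => ?_, fun g => ?_⟩
  · rw [skewVec, hsingle, map_one, mul_one, hF, Module.Basis.constr_basis]
  · rw [skewT, hsingle, map_one, one_mul]
    rfl

/-- `κ` has the values prescribed by the scalars `c`. -/
def Matches (χ : Fin n → G →* Kˣ) (Q : Fin n → Fin n → Kˣ)
    (κ : Fin n → Fin n → MonoidAlgebra K G) (c : Fin n → Fin n → G → K) : Prop :=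
  ∀ i j, i < j → ∀ g,
    ((∀ h, χ i h = (χ j h)⁻¹) → g ∈ Gij χ Q i j → (κ i j).coeff g = c i j g) ∧
    (¬ ((∀ h, χ i h = (χ j h)⁻¹) ∧ g ∈ Gij χ Q i j) → (κ i j).coeff g = 0)

theorem Matches.sum_eq {c : Fin n → Fin n → G → K} (hc : Matches χ Q κ c) {A : Type*} [Ring A]
    [Algebra K A] (t : G → A) {i j : Fin n} (hij : i < j) (hχ : ∀ h, χ i h = (χ j h)⁻¹) :
    ∑ g, (κ i j).coeff g • t g = ∑ g ∈ Gij χ Q i j, c i j g • t g := by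
  rw [← Finset.sum_subset (Finset.subset_univ (Gij χ Q i j))]
  · exact Finset.sum_congr rfl fun g hg => by rw [(hc i j hij g).1 hχ hg]
  · intro g _ hg
    rw [(hc i j hij g).2 fun h => hg h.2, zero_smul]

theorem Matches.sum_eq_zero {c : Fin n → Fin n → G → K} (hc : Matches χ Q κ c) {A : Type*} [Ring A]
    [Algebra K A] (t : G → A) {i j : Fin n} (hij : i < j) (hχ : ¬ ∀ h, χ i h = (χ j h)⁻¹) :
    ∑ g, (κ i j).coeff g • t g = 0 :=
  Finset.sum_eq_zero fun g _ => by rw [(hc i j hij g).2 fun h => hχ h.1, zero_smul]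

/-- The relation for `(j, i)` is a multiple of the one for `(i, j)`, and the diagonal ones are
trivial. This is why the factor algebras need relations only for `i < j`. -/
theorem isModel_of_lt {A : Type*} [Ring A] [Algebra K A] {v : Fin n → A} {t : G → A}
    (hQ : IsQuantumSystem Q) (hκ : IsQuantumTwoForm Q κ) (one : t 1 = 1)
    (mul : ∀ g h, t g * t h = t (g * h)) (act : ∀ g i, t g * v i = (χ i g : K) • (v i * t g))
    (comm : ∀ i j, i < j →
      v j * v i = (Q i j : K) • (v i * v j) + ∑ g, (κ i j).coeff g • t g) :
    IsModel χ Q κ v t where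
  one := one
  mul := mul
  act := act
  comm i j := by
    rcases lt_trichotomy i j with hij | rfl | hij
    · exact comm i j hij
    · simp [(hQ i i).2, (hκ i i).1]
    · rw [comm j i hij, (hκ j i).2, (hQ i j).1, smul_add, smul_smul, ← Units.val_mul,
        inv_mul_cancel, Units.val_one, one_smul, add_assoc, left_eq_add]
      simp [Finset.smul_sum, smul_smul]

theorem isFactor_of_matches (hQ : IsQuantumSystem Q) (hκ : IsQuantumTwoForm Q κ)
    {c : Fin n → Fin n → G → K} (hc : Matches χ Q κ c)
    (hχ : ∀ g i, ρ g (b i) = (χ i g : K) • b i) : IsFactor b ρ χ Q κ c := by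
  have hH := isModel_H (Q := Q) (κ := κ) hχ
  let π := RingQuot.mkAlgHom K (FactorRel b ρ χ Q c)
  have hF : IsModel χ Q κ (fun i => π (skewVec ρ (b i))) (fun g => π (skewT ρ g)) := by
    refine isModel_of_lt hQ hκ ?_ ?_ ?_ ?_
    · rw [skewT_one, map_one]
    · intro g h
      rw [← map_mul, skewT_mul]
    · intro g i
      rw [← map_mul, skewT_mul_skewVec, hχ, skewVec_smul, smul_mul_assoc, map_smul, map_mul]
    · intro i j hij
      by_cases h : ∀ g, χ i g = (χ j g)⁻¹
      · rw [hc.sum_eq _ hij h, ← map_mul]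
        refine (RingQuot.mkAlgHom_rel K (FactorRel.inverse i j hij h)).trans ?_
        simp only [map_add, map_smul, map_mul, map_sum, π]
      · rw [hc.sum_eq_zero _ hij h, ← map_mul, add_zero]
        refine (RingQuot.mkAlgHom_rel K (FactorRel.other i j hij h)).trans ?_
        simp only [map_smul, map_mul, π]
  obtain ⟨ψ, ψv, ψt⟩ := hF.exists_lift hχ
  obtain ⟨f, fv, ft⟩ := hH.exists_skew_lift hχ
  have hf : ∀ ⦃x y⦄, FactorRel b ρ χ Q c x y → f x = f y := by
    intro x y hxy
    cases hxy with
    | inverse i j hij h =>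
      simp only [map_mul, map_add, map_smul, map_sum, fv, ft]
      rw [hH.comm, hc.sum_eq _ hij h]
    | other i j hij h =>
      simp only [map_mul, map_smul, fv]
      rw [hH.comm, hc.sum_eq_zero _ hij h, add_zero]
  let φ : Factor b ρ χ Q c →ₐ[K] H b ρ Q κ := RingQuot.liftAlgHom K ⟨f, hf⟩
  have hφ (x : Skew ρ) : φ (π x) = f x := RingQuot.liftAlgHom_mkAlgHom_apply K f hf x
  refine ⟨AlgEquiv.ofAlgHom φ ψ (H.hom_ext (fun i => ?_) fun g => ?_)
    (RingQuot.ringQuot_ext' _ _ _ (skew_hom_ext (b := b) (fun i => ?_) fun g => ?_)),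
    fun i => ?_, fun g => ?_⟩
  · simp [ψv, hφ, fv]
  · simp [ψt, hφ, ft]
  · change ψ (φ (π _)) = π _
    rw [hφ, fv, ψv]
  · change ψ (φ (π _)) = π _
    rw [hφ, ft, ψt]
  · exact (hφ _).trans (fv i)
  · exact (hφ _).trans (ft g)

end

/-! ### Realising arbitrary scalars by an admissible form -/

section

variable {K V G : Type*} [Field K] [AddCommGroup V] [Module K V] [Group G] [Fintype G] {n : ℕ}
  {ρ : Representation K G V} {b : Module.Basis (Fin n) K V} {χ : Fin n → G →* Kˣ}
  {Q : Fin n → Fin n → Kˣ}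

/-- The coefficients of `κ` serve as `c`: admissibility says that they vanish wherever no scalar is
prescribed. -/
theorem Admissible.matches {κ : Fin n → Fin n → MonoidAlgebra K G} (h : Admissible χ Q κ) :
    Matches χ Q κ fun i j g => (κ i j).coeff g := fun i j hij g =>
  ⟨fun _ _ => rfl, fun hn => by
    by_contra hg
    exact hn ⟨h.inverse g i j hij.ne hg, by simpa [Gij] using h.char g i j hij.ne hg⟩⟩

open Classical in
/-- The value prescribed by the scalars `c` at a pair `i < j`. -/
def formValue (χ : Fin n → G →* Kˣ) (Q : Fin n → Fin n → Kˣ) (c : Fin n → Fin n → G → K)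
    (i j : Fin n) : MonoidAlgebra K G :=
  .ofCoeff (Finsupp.equivFunOnFinite.symm fun g =>
    if (∀ h, χ i h = (χ j h)⁻¹) ∧ g ∈ Gij χ Q i j then c i j g else 0)

/-- The quantum `2`-form with values prescribed by the scalars `c`. -/
def formOf (χ : Fin n → G →* Kˣ) (Q : Fin n → Fin n → Kˣ) (c : Fin n → Fin n → G → K)
    (i j : Fin n) : MonoidAlgebra K G :=
  if i < j then formValue χ Q c i j
  else if j < i then -((Q i j : K) • formValue χ Q c j i) else 0

theorem formOf_of_lt {c : Fin n → Fin n → G → K} {i j : Fin n} (hij : i < j) :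
    formOf χ Q c i j = formValue χ Q c i j := if_pos hij

theorem formOf_of_gt {c : Fin n → Fin n → G → K} {i j : Fin n} (hij : j < i) :
    formOf χ Q c i j = -((Q i j : K) • formValue χ Q c j i) := by
  rw [formOf, if_neg hij.not_gt, if_pos hij]

theorem of_formValue_ne_zero {c : Fin n → Fin n → G → K} {i j : Fin n} {g : G}
    (h : (formValue χ Q c i j).coeff g ≠ 0) : (∀ h, χ i h = (χ j h)⁻¹) ∧ g ∈ Gij χ Q i j := by
  by_contra hn
  exact h (if_neg hn)

theorem of_formOf_ne_zero {c : Fin n → Fin n → G → K} {i j : Fin n} {g : G} (hij : i ≠ j)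
    (hg : (formOf χ Q c i j).coeff g ≠ 0) :
    (∀ h, χ i h = (χ j h)⁻¹) ∧ ∀ k, k ≠ i → k ≠ j → χ k g = Q k i * Q k j := by
  rcases hij.lt_or_gt with hij | hij
  · rw [formOf_of_lt hij] at hg
    have := of_formValue_ne_zero hg
    exact ⟨this.1, by simpa [Gij] using this.2⟩
  · rw [formOf_of_gt hij] at hg
    have := of_formValue_ne_zero (χ := χ) (Q := Q) (c := c) (i := j) (j := i) (g := g)
      fun h0 => hg (by simp [h0])
    refine ⟨fun h => by rw [this.1 h, inv_inv], fun k hki hkj => ?_⟩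
    rw [mul_comm]
    exact (by simpa [Gij] using this.2 : ∀ k, k ≠ j → k ≠ i → χ k g = Q k j * Q k i) k hkj hki

theorem admissible_formOf (hQ : IsQuantumSystem Q) (c : Fin n → Fin n → G → K) :
    Admissible χ Q (formOf χ Q c) where
  system := hQ
  form i j := by
    refine ⟨by simp [formOf], ?_⟩
    rcases lt_trichotomy i j with hij | rfl | hij
    · rw [formOf_of_lt hij, formOf_of_gt hij, (hQ j i).1]
    · simp [formOf]
    · rw [formOf_of_lt hij, formOf_of_gt hij, smul_neg, neg_neg, smul_smul, ← Units.val_mul,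
        inv_mul_cancel, Units.val_one, one_smul]
  inverse _ _ _ hij hg := (of_formOf_ne_zero hij hg).1
  char _ _ _ hij hg := (of_formOf_ne_zero hij hg).2

theorem matches_formOf (c : Fin n → Fin n → G → K) : Matches χ Q (formOf χ Q c) c := by
  intro i j hij g
  rw [formOf_of_lt hij]
  exact ⟨fun h hg => if_pos ⟨h, hg⟩, fun h => if_neg h⟩

/-- Both algebras are identified with one factor algebra, generators matching, so monomials
correspond and the basis property transfers. -/
theorem IsFactor.isQuantumDrinfeldHecke {κ κ' : Fin n → Fin n → MonoidAlgebra K G}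
    {c : Fin n → Fin n → G → K} (h : IsFactor b ρ χ Q κ c) (h' : IsFactor b ρ χ Q κ' c)
    (hκ : IsQuantumDrinfeldHecke b ρ Q κ) : IsQuantumDrinfeldHecke b ρ Q κ' := by
  obtain ⟨φ, φv, φt⟩ := h
  obtain ⟨φ', φv', φt'⟩ := h'
  let e : H b ρ Q κ ≃ₐ[K] H b ρ Q κ' := φ.symm.trans φ'
  have he : e.toLinearMap ∘ H.monomial b ρ Q κ = H.monomial b ρ Q κ' := by
    funext x
    simp only [Function.comp_apply, AlgEquiv.toLinearMap_apply, H.monomial_eq, map_mon]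
    congr 1
    · funext i
      simp [e, ← φv, ← φv']
    · funext g
      simp [e, ← φt, ← φt']
  constructor
  · rw [← he]
    exact hκ.1.map' _ (LinearMap.ker_eq_bot.2 e.injective)
  · rw [← he, Set.range_comp, Submodule.span_image, hκ.2, Submodule.map_top]
    exact LinearMap.range_eq_top.2 e.surjective

end

end

end QuantumDrinfeldHecke

theorem mainTheorem6 {K V G : Type*} [Field K] [AddCommGroup V] [Module K V]
    [CommGroup G] [Fintype G] {n : ℕ} (b : Module.Basis (Fin n) K V)
    (ρ : Representation K G V) (χ : Fin n → G →* Kˣ)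
    (hχ : ∀ g i, ρ g (b i) = (χ i g : K) • b i) :
    (∀ (Q : Fin n → Fin n → Kˣ) (κ : Fin n → Fin n → MonoidAlgebra K G),
      QuantumDrinfeldHecke.IsQuantumDrinfeldHecke b ρ Q κ ↔
        QuantumDrinfeldHecke.IsQuantumSystem Q ∧
        QuantumDrinfeldHecke.IsQuantumTwoForm Q κ ∧
        ∀ (g : G) (i j : Fin n), i ≠ j → (κ i j).coeff g ≠ 0 →
          (∀ h, χ i h = (χ j h)⁻¹) ∧ ∀ k, k ≠ i → k ≠ j → χ k g = Q k i * Q k j) ∧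
    (∀ (Q : Fin n → Fin n → Kˣ) (κ : Fin n → Fin n → MonoidAlgebra K G),
      QuantumDrinfeldHecke.IsQuantumDrinfeldHecke b ρ Q κ ↔
        QuantumDrinfeldHecke.IsQuantumSystem Q ∧
        ∃ c : Fin n → Fin n → G → K, QuantumDrinfeldHecke.IsFactor b ρ χ Q κ c) ∧
    (∀ (Q : Fin n → Fin n → Kˣ), QuantumDrinfeldHecke.IsQuantumSystem Q →
      ∀ c : Fin n → Fin n → G → K, ∃ κ : Fin n → Fin n → MonoidAlgebra K G,
        QuantumDrinfeldHecke.IsQuantumDrinfeldHecke b ρ Q κ ∧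
        QuantumDrinfeldHecke.IsFactor b ρ χ Q κ c) := by
  open QuantumDrinfeldHecke in
  have key := fun Q κ => isQuantumDrinfeldHecke_iff_admissible (Q := Q) (κ := κ) hχ
  refine ⟨fun Q κ => (key Q κ).trans ⟨fun h => ⟨h.system, h.form, fun g i j hij hg =>
      ⟨h.inverse g i j hij hg, h.char g i j hij hg⟩⟩, fun h => ⟨h.1, h.2.1,
      fun g i j hij hg => (h.2.2 g i j hij hg).1, fun g i j hij hg => (h.2.2 g i j hij hg).2⟩⟩,
    fun Q κ => ⟨fun h => ?_, ?_⟩, fun Q hQ c => ?_⟩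
  · have hadm := (key Q κ).1 h
    exact ⟨hadm.system, _, isFactor_of_matches hadm.system hadm.form hadm.matches hχ⟩
  -- Nothing is known about `κ` itself, so the basis property is transported from the admissible
  -- form `formOf χ Q c`, which yields the same factor algebra.
  · rintro ⟨hQ, c, hc⟩
    have hadm := admissible_formOf (χ := χ) hQ c
    exact (isFactor_of_matches hadm.system hadm.form (matches_formOf c) hχ).isQuantumDrinfeldHecke
      hc (hadm.isQuantumDrinfeldHecke hχ)
  · have hadm := admissible_formOf (χ := χ) hQ c
    exact ⟨_, hadm.isQuantumDrinfeldHecke hχ,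
      isFactor_of_matches hadm.system hadm.form (matches_formOf c) hχ⟩
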